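/- Fix $\kappa>0$, $V>0$, $|\sigma|\le 1$, $T>0$. A \emph{quasi-static profile} on $[a,b]$, $a<b$, of volume $V$ is a function $u\in C^2(a,b)\cap C^1([a,b])$ such that, for some $\lambda\in\mathbb R$, $$\frac{\partial}{\partial x}\Big(\frac{\partial_x u}{\sqrt{1+(\partial_x u)^2}}\Big)-\kappa u+\lambda=0 \text{ on }(a,b),\qquad u(a)=u(b)=0,\qquad \int_a^b u\,dx=V .$$ \textbf{Exact solution.} Let $a,b\in C^2([0,T])$ and $u(\cdot,t),\lambda(t)$, $t\in[0,T]$, be such that, for every $t\in[0,T]$, $u(\cdot,t)$ is a quasi-static profile on $[a(t),b(t)]$ of volume $V$ with multiplier $\lambda(t)$, and $$a'(t)=\sigma+\frac1{\sqrt{1+(\partial_xu(a(t),t))^2}},\qquad b'(t)=-\sigma-\frac1{\sqrt{1+(\partial_xu(b(t),t))^2}},$$ with one-sided spatial derivatives at the contact points. \textbf{First order scheme.} Let $\Delta t>0$, $t^n=n\Delta t$, and let $N\ge 0$ be an integer with $N\Delta t\le T$. Start from the same data $a^0=a(0)$, $b^0=b(0)$, $u^0=u(\cdot,0)$, and suppose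 that $(a^n,b^n,u^n)$, $n\le N$, is a solution of the scheme: for $0\le n<N$, $$\frac{a^{n+1}-a^n}{\Delta t}=\sigma+\frac1{\sqrt{1+(\partial_xu^n(a^n))^2}},\qquad \frac{b^{n+1}-b^n}{\Delta t}=-\sigma-\frac1{\sqrt{1+(\partial_xu^n(b^n))^2}},$$ and $u^{n+1}$ is a quasi-static profile on $[a^{n+1},b^{n+1}]$ of volume $\int_{a^0}^{b^0}u^0\,dx$ (with its own multiplier $\lambda^{n+1}$). \textbf{The constant.} Let $[l,r]$ be any compact interval that contains the half-widths $\frac{b(t)-a(t)}2$ for all $t\in[0,T]$ and $\frac{b^n-a^n}2$ for all $n\le N$ (for symmetric data, $a=-b$, these are $b(t)$ and $b^n$). Put $$C_m=\sup\frac{1}{V-\beta u_m}\Big(\frac{6V}{u_m}+\kappa u_m^3\Big),$$ where the supremum is over all $\beta\in[l,r]$ for which there is a quasi-static profile on $[-\beta,\beta]$ of volume $V$, and $u_m$ is the maximum of such a profile. Thus $C_m$ depends only on $\kappa,V,l,r$. \textbf{Theorem.} $C_m$ is finite (the supremum of a nonempty set that is bounded above), and for all $0\le n\le N$ $$|b(t^n)-b^n|\le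 e^{C_mT}\,\Delta t,\qquad |a(t^n)-a^n|\le e^{C_mT}\,\Delta t .$$ -/

import Mathlib

open Set

noncomputable section

/-- A classical quasi-static droplet profile on the wetted interval `[a, b]`:
`u` is `C²` on `(a, b)` and `C¹` up to the contact points, and it solves
`(u_x / √(1 + u_x²))_x - κ u + lam = 0` in `(a, b)`, `u(a) = u(b) = 0`, `∫ₐᵇ u = V`,
where `lam` is the Lagrange multiplier of the volume constraint. -/
structure IsQuasiStaticProfile (κ V a b : ℝ) (u : ℝ → ℝ) (lam : ℝ) : Prop where
  lt : a < b
  contDiffOn_Icc : ContDiffOn ℝ 1 u (Icc a b)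
  contDiffOn_Ioo : ContDiffOn ℝ 2 u (Ioo a b)
  equation : ∀ x ∈ Ioo a b,
    deriv (fun y => deriv u y / √(1 + (deriv u y) ^ 2)) x - κ * u x + lam = 0
  left_zero : u a = 0
  right_zero : u b = 0
  volume : ∫ x in a..b, u x = V

/-- The cosine `1 / √(1 + (∂ₓu)²)` of the contact angle at the left contact point `a`, computed
with the one-sided derivative of `u` at `a`. -/
def cosAngleLeft (a b : ℝ) (u : ℝ → ℝ) : ℝ :=
  1 / √(1 + (derivWithin u (Icc a b) a) ^ 2)

/-- The cosine `1 / √(1 + (∂ₓu)²)` of the contact angle at the right contact point `b`, computed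
with the one-sided derivative of `u` at `b`. -/
def cosAngleRight (a b : ℝ) (u : ℝ → ℝ) : ℝ :=
  1 / √(1 + (derivWithin u (Icc a b) b) ^ 2)

/-- Exact solution on `[0, T]` of the quasi-static droplet dynamics with contact points
`a(t) < b(t)` of class `C²`, capillary surface `u t x` and multiplier `lam t`. -/
structure IsQuasiStaticSolution (κ V σ T : ℝ) (a b : ℝ → ℝ) (u : ℝ → ℝ → ℝ) (lam : ℝ → ℝ) :
    Prop where
  contDiffOn_left : ContDiffOn ℝ 2 a (Icc 0 T)
  contDiffOn_right : ContDiffOn ℝ 2 b (Icc 0 T)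
  profile : ∀ t ∈ Icc 0 T, IsQuasiStaticProfile κ V (a t) (b t) (u t) (lam t)
  left_speed : ∀ t ∈ Icc 0 T,
    HasDerivWithinAt a (σ + cosAngleLeft (a t) (b t) (u t)) (Icc 0 T) t
  right_speed : ∀ t ∈ Icc 0 T,
    HasDerivWithinAt b (-σ - cosAngleRight (a t) (b t) (u t)) (Icc 0 T) t

/-- The first `N` steps of the first order scheme with time step `dt`: an explicit update of the
contact points, followed by an implicit elliptic solve for the capillary surface on the new wetted
interval, with the volume of the initial surface. -/
structure IsFirstOrderScheme (κ σ dt : ℝ) (N : ℕ) (a b : ℕ → ℝ) (u : ℕ → ℝ → ℝ) (lam : ℕ → ℝ) :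
    Prop where
  left_update : ∀ n < N,
    (a (n + 1) - a n) / dt = σ + cosAngleLeft (a n) (b n) (u n)
  right_update : ∀ n < N,
    (b (n + 1) - b n) / dt = -σ - cosAngleRight (a n) (b n) (u n)
  elliptic : ∀ n < N,
    IsQuasiStaticProfile κ (∫ x in (a 0)..(b 0), u 0 x) (a (n + 1)) (b (n + 1)) (u (n + 1))
      (lam (n + 1))

/-- The values of `(6 V / u_m + κ u_m³) / (V - β u_m)`, where `β` ranges over the half-widths in
`[l, r]` for which there is a quasi-static profile on `[-β, β]`, and `u_m` is the maximum of that
profile. -/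
def angleBoundValues (κ V l r : ℝ) : Set ℝ :=
  {c | ∃ β ∈ Icc l r, ∃ (u : ℝ → ℝ) (lam um : ℝ),
    IsQuasiStaticProfile κ V (-β) β u lam ∧ IsGreatest (u '' Icc (-β) β) um ∧
      c = 1 / (V - β * um) * (6 * V / um + κ * um ^ 3)}

/-- The constant `C_m` for half-widths in `[l, r]`. -/
def angleBound (κ V l r : ℝ) : ℝ := sSup (angleBoundValues κ V l r)

end

/-! At fixed volume, the cosine of the contact angle is a nondecreasing function of the width alone:
two profiles sharing a left endpoint are compared by a minimum principle (`derivWithin_left_le`,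
`cosAngleLeft_le`). Applied to a profile and its reflection, this makes both contact angles equal,
so `a + b` is conserved by the flow and by the scheme. Hence `b` alone solves a scalar autonomous
equation whose right-hand side is nonincreasing and takes values in an interval of length one.

For such an equation no Gronwall argument is needed: monotonicity prevents errors from accumulating,
and explicit Euler stays within one time step of the solution (`euler_error`). The factor `exp (C_m
T)` only has to be at least one, which is `0 ≤ C_m`.

Finiteness of `C_m` requires `V - β u_m` to stay away from zero. The triangle under the maximum has
area `β u_m`; a cubic barrier adds a quantitative surplus to it (`cubic_le`, `volume_lower_bound`).
A first integral bounds `u_m` above, and the volume bounds `u_m` and `β` below. -/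

/-! ### Minimum principle -/

/-- A weak minimum principle for functions that are strictly concave at their negative critical
points. -/
theorem nonneg_of_deriv_deriv_neg {f : ℝ → ℝ} {c d : ℝ} (hf : ContinuousOn f (Icc c d))
    (hc : 0 ≤ f c) (hd : 0 ≤ f d)
    (h : ∀ x ∈ Ioo c d, f x < 0 → deriv f x = 0 → deriv (deriv f) x < 0) :
    ∀ x ∈ Icc c d, 0 ≤ f x := by
  intro x hx
  by_contra! hneg
  obtain ⟨y, hy, hmin⟩ := isCompact_Icc.exists_isMinOn ⟨x, hx⟩ hf
  have hy0 : f y < 0 := lt_of_le_of_lt (hmin hx) hneg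
  have hyo : y ∈ Ioo c d := by
    refine ⟨lt_of_le_of_ne hy.1 ?_, lt_of_le_of_ne hy.2 ?_⟩ <;> rintro rfl <;> linarith
  have hnhds : Icc c d ∈ nhds y := Icc_mem_nhds hyo.1 hyo.2
  have hloc : IsLocalMin f y := hmin.isLocalMin hnhds
  have hd1 := hloc.deriv_eq_zero
  have hd2 := h y hyo hy0 hd1
  -- The negative minimum is also a local maximum by the second derivative test, so `f` is locally
  -- constant and its second derivative vanishes there.
  have hmax : IsLocalMax f y := isLocalMax_of_deriv_deriv_neg hd2 hd1 (hf.continuousAt hnhds)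
  have heq : f =ᶠ[nhds y] fun _ => f y := by
    filter_upwards [hloc, hmax] with z h1 h2 using le_antisymm h2 h1
  have h2 := heq.deriv.deriv_eq
  simp at h2
  linarith

/-- A continuous function with nonpositive integral that is positive somewhere is
negative somewhere. -/
theorem exists_neg_of_integral_nonpos {f : ℝ → ℝ} {c d x : ℝ} (hf : ContinuousOn f (Icc c d))
    (hcd : c < d) (hx : x ∈ Icc c d) (hpos : 0 < f x) (hint : ∫ y in c..d, f y ≤ 0) :
    ∃ y ∈ Icc c d, f y < 0 := by
  by_contra! hcon
  have : 0 < ∫ y in c..d, f y :=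
    intervalIntegral.integral_pos hcd hf (fun y hy => hcon y (Ioc_subset_Icc_self hy)) ⟨x, hx, hpos⟩
  linarith

/-! ### Basic properties and symmetries of profiles -/

namespace IsQuasiStaticProfile

variable {κ V a b lam : ℝ} {u : ℝ → ℝ}

theorem continuousOn (h : IsQuasiStaticProfile κ V a b u lam) : ContinuousOn u (Icc a b) :=
  h.contDiffOn_Icc.continuousOn

theorem differentiableAt (h : IsQuasiStaticProfile κ V a b u lam) {x : ℝ} (hx : x ∈ Ioo a b) :
    DifferentiableAt ℝ u x :=
  (h.contDiffOn_Ioo.differentiableOn (by norm_num)).differentiableAt (isOpen_Ioo.mem_nhds hx)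

theorem differentiableAt_deriv (h : IsQuasiStaticProfile κ V a b u lam) {x : ℝ}
    (hx : x ∈ Ioo a b) : DifferentiableAt ℝ (deriv u) x := by
  have h2 : ContDiffOn ℝ (1 + 1) u (Ioo a b) := by
    have := h.contDiffOn_Ioo
    rwa [show (2 : WithTop ℕ∞) = 1 + 1 by norm_num] at this
  rw [contDiffOn_succ_iff_deriv_of_isOpen isOpen_Ioo] at h2
  exact (h2.2.2.differentiableOn (by norm_num)).differentiableAt (isOpen_Ioo.mem_nhds hx)

theorem deriv_deriv (h : IsQuasiStaticProfile κ V a b u lam) {x : ℝ} (hx : x ∈ Ioo a b) :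
    deriv (deriv u) x = (κ * u x - lam) * √(1 + deriv u x ^ 2) ^ 3 := by
  have hp := (h.differentiableAt_deriv hx).hasDerivAt
  have hpos : 0 < 1 + deriv u x ^ 2 := by positivity
  have hsq := Real.sq_sqrt hpos.le
  have hs : 0 < √(1 + deriv u x ^ 2) := Real.sqrt_pos.2 hpos
  have hsd : HasDerivAt (fun y => √(1 + deriv u y ^ 2))
      (2 * deriv u x * deriv (deriv u) x / (2 * √(1 + deriv u x ^ 2))) x := by
    simpa using ((hp.fun_pow 2).const_add 1).sqrt hpos.ne'
  have hq := (hp.div hsd hs.ne').deriv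
  have heq := h.equation x hx
  have hfun : (deriv u / fun y => √(1 + deriv u y ^ 2)) =
    fun y => deriv u y / √(1 + deriv u y ^ 2) := rfl
  rw [hfun] at hq
  rw [hq] at heq
  have : κ * u x - lam = deriv (deriv u) x / √(1 + deriv u x ^ 2) ^ 3 := by
    rw [sub_add] at heq
    rw [← sub_eq_zero.1 heq]
    set s := √(1 + deriv u x ^ 2)
    field_simp
    linear_combination (deriv (deriv u) x) * hsq
  rw [this]
  field_simp

theorem exists_argmax (h : IsQuasiStaticProfile κ V a b u lam) (hV : 0 < V) :
    ∃ x ∈ Ioo a b, IsMaxOn u (Icc a b) x ∧ 0 < u x := by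
  obtain ⟨x, hx, hmax⟩ := isCompact_Icc.exists_isMaxOn (nonempty_Icc.2 h.lt.le) h.continuousOn
  have hpos : 0 < u x := by
    by_contra! hle
    have : ∫ y in a..b, u y ≤ 0 := by
      have := intervalIntegral.integral_mono_on (μ := MeasureTheory.volume) h.lt.le
        (h.continuousOn.intervalIntegrable_of_Icc h.lt.le)
        (intervalIntegrable_const (c := (0 : ℝ)))
        fun y hy => (hmax hy).trans hle
      simpa using this
    linarith [h.volume]
  refine ⟨x, ⟨lt_of_le_of_ne hx.1 ?_, lt_of_le_of_ne hx.2 ?_⟩, hmax, hpos⟩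
  · rintro rfl; linarith [h.left_zero]
  · rintro rfl; linarith [h.right_zero]

/-- Otherwise the equation gives `u'' > 0` at the maximum, which would then also be a local minimum,
forcing `u` to be locally constant. -/
theorem mul_argmax_le (h : IsQuasiStaticProfile κ V a b u lam) {x : ℝ} (hx : x ∈ Ioo a b)
    (hmax : IsMaxOn u (Icc a b) x) : κ * u x ≤ lam := by
  have hnhds : Icc a b ∈ nhds x := Icc_mem_nhds hx.1 hx.2
  have hloc : IsLocalMax u x := hmax.isLocalMax hnhds
  by_contra! hlt
  have hd2 : 0 < deriv (deriv u) x := by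
    rw [h.deriv_deriv hx]
    exact mul_pos (by linarith) (by positivity)
  have hmin := isLocalMin_of_deriv_deriv_pos hd2 hloc.deriv_eq_zero (h.continuousOn.continuousAt hnhds)
  have heq : u =ᶠ[nhds x] fun _ => u x := by
    filter_upwards [hmin, hloc] with z h1 h2 using le_antisymm h2 h1
  have h2 := heq.deriv.deriv_eq
  simp at h2
  linarith

theorem multiplier_pos (h : IsQuasiStaticProfile κ V a b u lam) (hκ : 0 < κ) (hV : 0 < V) :
    0 < lam := by
  obtain ⟨x, hx, hmax, hpos⟩ := h.exists_argmax hV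
  exact (mul_pos hκ hpos).trans_le (h.mul_argmax_le hx hmax)

theorem nonneg (h : IsQuasiStaticProfile κ V a b u lam) (hκ : 0 < κ) (hV : 0 < V) :
    ∀ x ∈ Icc a b, 0 ≤ u x := by
  refine nonneg_of_deriv_deriv_neg h.continuousOn h.left_zero.ge h.right_zero.ge ?_
  intro x hx hneg _
  rw [h.deriv_deriv hx]
  have := h.multiplier_pos hκ hV
  exact mul_neg_of_neg_of_pos (by nlinarith) (by positivity)

/-- Needed because the discrete initial surface agrees with the exact one only on the wetted
interval. -/
theorem congr (h : IsQuasiStaticProfile κ V a b u lam) {v : ℝ → ℝ} (huv : EqOn v u (Icc a b)) :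
    IsQuasiStaticProfile κ V a b v lam where
  lt := h.lt
  contDiffOn_Icc := h.contDiffOn_Icc.congr huv
  contDiffOn_Ioo := h.contDiffOn_Ioo.congr (huv.mono Ioo_subset_Icc_self)
  equation x hx := by
    have he : v =ᶠ[nhds x] u := by
      filter_upwards [Icc_mem_nhds hx.1 hx.2] with y hy using huv hy
    have hd : (fun y => deriv v y / √(1 + deriv v y ^ 2)) =ᶠ[nhds x]
        fun y => deriv u y / √(1 + deriv u y ^ 2) := by
      filter_upwards [he.deriv] with y hy
      rw [hy]
    rw [hd.deriv_eq, he.eq_of_nhds]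
    exact h.equation x hx
  left_zero := by rw [huv (left_mem_Icc.2 h.lt.le), h.left_zero]
  right_zero := by rw [huv (right_mem_Icc.2 h.lt.le), h.right_zero]
  volume := by
    rw [← h.volume]
    exact intervalIntegral.integral_congr (by rwa [uIcc_of_le h.lt.le])

theorem comp_add_const (h : IsQuasiStaticProfile κ V a b u lam) (d : ℝ) :
    IsQuasiStaticProfile κ V (a - d) (b - d) (fun x => u (x + d)) lam where
  lt := by linarith [h.lt]
  contDiffOn_Icc := h.contDiffOn_Icc.comp (by fun_prop) fun x hx => by
    constructor <;> linarith [hx.1, hx.2]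
  contDiffOn_Ioo := h.contDiffOn_Ioo.comp (by fun_prop) fun x hx => by
    constructor <;> linarith [hx.1, hx.2]
  equation x hx := by
    simp only [deriv_comp_add_const]
    rw [deriv_comp_add_const (fun y => deriv u y / √(1 + deriv u y ^ 2)) d x]
    exact h.equation (x + d) (by constructor <;> linarith [hx.1, hx.2])
  left_zero := by simpa using h.left_zero
  right_zero := by simpa using h.right_zero
  volume := by
    rw [intervalIntegral.integral_comp_add_right]
    simpa using h.volume

theorem comp_const_sub (h : IsQuasiStaticProfile κ V a b u lam) (d : ℝ) :
    IsQuasiStaticProfile κ V (d - b) (d - a) (fun x => u (d - x)) lam where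
  lt := by linarith [h.lt]
  contDiffOn_Icc := h.contDiffOn_Icc.comp (by fun_prop) fun x hx => by
    constructor <;> linarith [hx.1, hx.2]
  contDiffOn_Ioo := h.contDiffOn_Ioo.comp (by fun_prop) fun x hx => by
    constructor <;> linarith [hx.1, hx.2]
  equation x hx := by
    have hfun : (fun y => deriv (fun x => u (d - x)) y / √(1 + deriv (fun x => u (d - x)) y ^ 2)) =
        fun y => -(fun z => deriv u z / √(1 + deriv u z ^ 2)) (d - y) := by
      funext y
      simp only [deriv_comp_const_sub]
      rw [neg_sq, neg_div]
    rw [hfun, deriv.fun_neg,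
      deriv_comp_const_sub (fun z => deriv u z / √(1 + deriv u z ^ 2)), neg_neg]
    exact h.equation (d - x) (by constructor <;> linarith [hx.1, hx.2])
  left_zero := by simpa using h.right_zero
  right_zero := by simpa using h.left_zero
  volume := by
    rw [intervalIntegral.integral_comp_sub_left]
    simpa using h.volume

end IsQuasiStaticProfile

/-! ### Monotonicity of the contact angle in the width -/

namespace IsQuasiStaticProfile

variable {κ V a b lam : ℝ} {u : ℝ → ℝ}

theorem hasDerivWithinAt_left (h : IsQuasiStaticProfile κ V a b u lam) :
    HasDerivWithinAt u (derivWithin u (Icc a b) a) (Ioi a) a :=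
  (((h.contDiffOn_Icc.differentiableOn (by norm_num)) a
    (left_mem_Icc.2 h.lt.le)).hasDerivWithinAt).mono_of_mem_nhdsWithin (Icc_mem_nhdsGT h.lt)

theorem derivWithin_left_nonneg (h : IsQuasiStaticProfile κ V a b u lam) (hκ : 0 < κ)
    (hV : 0 < V) : 0 ≤ derivWithin u (Icc a b) a := by
  have hd := h.hasDerivWithinAt_left
  rw [hasDerivWithinAt_iff_tendsto_slope' self_notMem_Ioi] at hd
  refine ge_of_tendsto hd ?_
  filter_upwards [Icc_mem_nhdsGT h.lt, self_mem_nhdsWithin] with x hx hxa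
  rw [slope_def_field, h.left_zero, sub_zero]
  exact div_nonneg (h.nonneg hκ hV x hx) (sub_nonneg.2 hx.1)

/-- Where the slopes agree, the two curvature equations carry the same nonlinear factor, so their
difference is linear in the difference of the profiles. -/
theorem deriv_deriv_sub {b₁ b₂ lam₁ lam₂ : ℝ} {u₁ u₂ : ℝ → ℝ}
    (h₁ : IsQuasiStaticProfile κ V a b₁ u₁ lam₁) (h₂ : IsQuasiStaticProfile κ V a b₂ u₂ lam₂)
    {x : ℝ} (hx₁ : x ∈ Ioo a b₁) (hx₂ : x ∈ Ioo a b₂) (hx : deriv (u₂ - u₁) x = 0) :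
    deriv (deriv (u₂ - u₁)) x =
      (κ * (u₂ - u₁) x - (lam₂ - lam₁)) * √(1 + deriv u₁ x ^ 2) ^ 3 := by
  rw [deriv_sub (h₂.differentiableAt hx₂) (h₁.differentiableAt hx₁), sub_eq_zero] at hx
  have heq : deriv (u₂ - u₁) =ᶠ[nhds x] deriv u₂ - deriv u₁ := by
    filter_upwards [isOpen_Ioo.mem_nhds hx₁, isOpen_Ioo.mem_nhds hx₂] with y hy₁ hy₂
    exact deriv_sub (h₂.differentiableAt hy₂) (h₁.differentiableAt hy₁)
  rw [heq.deriv_eq, deriv_sub (h₂.differentiableAt_deriv hx₂) (h₁.differentiableAt_deriv hx₁),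
    h₁.deriv_deriv hx₁, h₂.deriv_deriv hx₂, hx, Pi.sub_apply]
  ring

/-- Among profiles of equal volume with a common left endpoint, the wider one is less steep at
that endpoint. -/
theorem derivWithin_left_le {b₁ b₂ lam₁ lam₂ : ℝ} {u₁ u₂ : ℝ → ℝ}
    (h₁ : IsQuasiStaticProfile κ V a b₁ u₁ lam₁) (h₂ : IsQuasiStaticProfile κ V a b₂ u₂ lam₂)
    (hκ : 0 < κ) (hV : 0 < V) (hb : b₁ ≤ b₂) :
    derivWithin u₂ (Icc a b₂) a ≤ derivWithin u₁ (Icc a b₁) a := by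
  by_contra! hlt
  have hsub : Icc a b₁ ⊆ Icc a b₂ := Icc_subset_Icc le_rfl hb
  have hcont : ContinuousOn (u₂ - u₁) (Icc a b₁) := (h₂.continuousOn.mono hsub).sub h₁.continuousOn
  have hwa : (u₂ - u₁) a = 0 := by simp [h₁.left_zero, h₂.left_zero]
  have hwb : 0 ≤ (u₂ - u₁) b₁ := by
    simpa [h₁.right_zero] using h₂.nonneg hκ hV b₁ ⟨h₁.lt.le, hb⟩
  have hpos : ∀ᶠ x in nhdsWithin a (Ioi a), 0 < (u₂ - u₁) x := by
    have hd := h₂.hasDerivWithinAt_left.sub h₁.hasDerivWithinAt_left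
    rw [hasDerivWithinAt_iff_tendsto_slope' self_notMem_Ioi] at hd
    filter_upwards [hd.eventually_const_lt (sub_pos.2 hlt), self_mem_nhdsWithin] with x hx hxa
    rw [slope_def_field, hwa, sub_zero] at hx
    exact (div_pos_iff_of_pos_right (sub_pos.2 hxa)).1 hx
  obtain ⟨x, hxpos, hx⟩ := (hpos.and (Icc_mem_nhdsGT h₁.lt)).exists
  -- `u₂` spends part of its volume on `[b₁, b₂]`, where it is nonnegative. The difference, positive
  -- near `a`, must therefore become negative at some `y`.
  have hint : ∫ y in a..b₁, (u₂ - u₁) y ≤ 0 := by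
    have hi₁ := h₁.continuousOn.intervalIntegrable_of_Icc (μ := MeasureTheory.volume) h₁.lt.le
    have hi₂ := (h₂.continuousOn.mono hsub).intervalIntegrable_of_Icc
      (μ := MeasureTheory.volume) h₁.lt.le
    have hi₃ := (h₂.continuousOn.mono (Icc_subset_Icc h₁.lt.le le_rfl)).intervalIntegrable_of_Icc
      (μ := MeasureTheory.volume) hb
    have hadd := intervalIntegral.integral_add_adjacent_intervals hi₂ hi₃
    have hnn : 0 ≤ ∫ y in b₁..b₂, u₂ y := intervalIntegral.integral_nonneg hb
      fun y hy => h₂.nonneg hκ hV y ⟨h₁.lt.le.trans hy.1, hy.2⟩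
    simp only [Pi.sub_apply]
    rw [intervalIntegral.integral_sub hi₂ hi₁, h₁.volume]
    linarith [h₂.volume]
  obtain ⟨y, hy, hyneg⟩ := exists_neg_of_integral_nonpos hcont h₁.lt hx hxpos hint
  have hay : a < y := lt_of_le_of_ne hy.1 (by rintro rfl; linarith)
  -- The sign of `lam₂ - lam₁` decides which of `u₂ - u₁` and `u₁ - u₂` obeys the minimum principle.
  -- The first contradicts the negative value at `y`; the second, used on `[a, y]`, contradicts
  -- positivity near `a`.
  rcases le_total lam₁ lam₂ with hlam | hlam
  · have := nonneg_of_deriv_deriv_neg hcont hwa.ge hwb (fun z hz hz0 hz1 => by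
      rw [deriv_deriv_sub h₁ h₂ hz ⟨hz.1, hz.2.trans_le hb⟩ hz1]
      have := mul_neg_of_pos_of_neg hκ hz0
      exact mul_neg_of_neg_of_pos (by linarith) (by positivity)) y hy
    linarith
  · obtain ⟨z, hzpos, hz⟩ := (hpos.and (Icc_mem_nhdsGT hay)).exists
    have := nonneg_of_deriv_deriv_neg (f := -(u₂ - u₁))
      (hcont.mono (Icc_subset_Icc le_rfl hy.2)).neg (by simp [hwa])
      (by rw [Pi.neg_apply]; linarith) (fun t ht ht0 ht1 => by
        have ht' : t ∈ Ioo a b₁ := ⟨ht.1, ht.2.trans_le hy.2⟩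
        rw [deriv.neg', neg_eq_zero] at ht1
        rw [deriv.neg', deriv.fun_neg, deriv_deriv_sub h₁ h₂ ht' ⟨ht'.1, ht'.2.trans_le hb⟩ ht1,
          neg_lt_zero]
        rw [Pi.neg_apply, neg_lt_zero] at ht0
        have := mul_pos hκ ht0
        exact mul_pos (by linarith) (by positivity)) z hz
    rw [Pi.neg_apply] at this
    linarith

/-- The contact angle at the left endpoint decreases with the width at fixed volume. -/
theorem cosAngleLeft_le {a₁ b₁ a₂ b₂ lam₁ lam₂ : ℝ} {u₁ u₂ : ℝ → ℝ}
    (h₁ : IsQuasiStaticProfile κ V a₁ b₁ u₁ lam₁) (h₂ : IsQuasiStaticProfile κ V a₂ b₂ u₂ lam₂)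
    (hκ : 0 < κ) (hV : 0 < V) (hw : b₁ - a₁ ≤ b₂ - a₂) :
    cosAngleLeft a₁ b₁ u₁ ≤ cosAngleLeft a₂ b₂ u₂ := by
  have h₃ := h₂.comp_add_const (a₂ - a₁)
  rw [sub_sub_cancel] at h₃
  have hle := derivWithin_left_le h₁ h₃ hκ hV (by linarith)
  have hd : derivWithin (fun x => u₂ (x + (a₂ - a₁))) (Icc a₁ (b₂ - (a₂ - a₁))) a₁ =
      derivWithin u₂ (Icc a₂ b₂) a₂ := by
    rw [derivWithin_comp_add_const, add_sub_cancel, ← image_vadd]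
    simp [sub_sub]
  rw [hd] at hle
  have h0 := h₂.derivWithin_left_nonneg hκ hV
  unfold cosAngleLeft
  gcongr

/-- A profile and its reflection have equal width and volume, so the monotonicity applies in both
directions. -/
theorem cosAngleRight_eq_cosAngleLeft (h : IsQuasiStaticProfile κ V a b u lam)
    (hκ : 0 < κ) (hV : 0 < V) : cosAngleRight a b u = cosAngleLeft a b u := by
  have h₂ := h.comp_const_sub (a + b)
  rw [add_sub_cancel_right, add_sub_cancel_left] at h₂
  have heq := le_antisymm (cosAngleLeft_le h₂ h hκ hV le_rfl) (cosAngleLeft_le h h₂ hκ hV le_rfl)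
  rw [← heq]
  unfold cosAngleLeft cosAngleRight
  rw [derivWithin_comp_const_sub]
  simp

theorem cosAngleLeft_mem_Icc (a b : ℝ) (u : ℝ → ℝ) : cosAngleLeft a b u ∈ Icc 0 1 := by
  unfold cosAngleLeft
  refine ⟨by positivity, div_le_one_of_le₀ ?_ (by positivity)⟩
  rw [Real.one_le_sqrt]
  nlinarith [sq_nonneg (derivWithin u (Icc a b) a)]

end IsQuasiStaticProfile

/-! ### Explicit Euler for monotone scalar equations -/

/-- A solution of a scalar autonomous equation with nonincreasing right-hand side that starts with
nonpositive velocity keeps a nonpositive velocity. -/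
theorem velocity_nonpos {x F : ℝ → ℝ} {T : ℝ}
    (hx : ∀ t ∈ Icc 0 T, HasDerivWithinAt x (F t) (Icc 0 T) t)
    (hF : ContinuousOn F (Icc 0 T))
    (hanti : ∀ s ∈ Icc 0 T, ∀ t ∈ Icc 0 T, x s ≤ x t → F t ≤ F s)
    (h0 : F 0 ≤ 0) : ∀ t ∈ Icc 0 T, F t ≤ 0 := by
  intro t ht
  by_contra! hpos
  have hsub : Icc 0 t ⊆ Icc 0 T := Icc_subset_Icc le_rfl ht.2
  have hcl : IsClosed (Icc 0 t ∩ F ⁻¹' Iic 0) :=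
    (hF.mono hsub).preimage_isClosed_of_isClosed isClosed_Icc isClosed_Iic
  -- `s` is the last time up to `t` with nonpositive velocity. After it `x` increases, so
  -- monotonicity yields `F t ≤ F s ≤ 0`.
  obtain ⟨s, ⟨hs, hFs⟩, hmax⟩ := (isCompact_Icc.of_isClosed_subset hcl inter_subset_left).exists_isMaxOn
    ⟨0, ⟨le_rfl, ht.1⟩, h0⟩ continuousOn_id
  have hst : s ≤ t := hs.2
  have hmono : MonotoneOn x (Icc s t) := by
    have hsub' : Icc s t ⊆ Icc 0 T := fun y hy => ⟨hs.1.trans hy.1, hy.2.trans ht.2⟩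
    refine monotoneOn_of_hasDerivWithinAt_nonneg (convex_Icc s t)
      (fun y hy => ((hx y (hsub' hy)).continuousWithinAt).mono hsub')
      (fun y hy => (hx y (hsub' (interior_subset hy))).mono (interior_subset.trans hsub')) ?_
    intro y hy
    rw [interior_Icc] at hy
    by_contra! hy0
    have : y ≤ s := hmax ⟨⟨hs.1.trans hy.1.le, hy.2.le⟩, hy0.le⟩
    linarith [hy.1]
  have := hanti s (hsub hs) t ht (hmono (left_mem_Icc.2 hst) (right_mem_Icc.2 hst) hst)
  simp only [mem_preimage, mem_Iic] at hFs
  linarith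

/-- Error of the explicit Euler method for a scalar autonomous equation whose right-hand side is
nonincreasing with oscillation at most one, when the initial velocity is nonpositive. -/
theorem euler_error_of_nonpos {x F : ℝ → ℝ} {y G : ℕ → ℝ} {T dt m : ℝ} {N : ℕ}
    (hdt : 0 < dt) (hN : N * dt ≤ T)
    (hx : ∀ t ∈ Icc 0 T, HasDerivWithinAt x (F t) (Icc 0 T) t)
    (hF : ContinuousOn F (Icc 0 T))
    (hanti : ∀ s ∈ Icc 0 T, ∀ t ∈ Icc 0 T, x s ≤ x t → F t ≤ F s)
    (hy : ∀ n < N, y (n + 1) = y n + dt * G n) (h0 : y 0 = x 0)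
    (hle : ∀ n ≤ N, ∀ t ∈ Icc 0 T, x t ≤ y n → G n ≤ F t)
    (hge : ∀ n ≤ N, ∀ t ∈ Icc 0 T, y n ≤ x t → F t ≤ G n)
    (hFm : ∀ t ∈ Icc 0 T, m ≤ F t)
    (hGm : ∀ n ≤ N, G n ∈ Icc m (m + 1))
    (hF0 : F 0 ≤ 0) : ∀ n ≤ N, |x (n * dt) - y n| ≤ dt := by
  have hT : 0 ≤ T := le_trans (by positivity) hN
  have hneg := velocity_nonpos hx hF hanti hF0
  have hxanti : AntitoneOn x (Icc 0 T) :=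
    antitoneOn_of_hasDerivWithinAt_nonpos (convex_Icc 0 T)
      (fun t ht => (hx t ht).continuousWithinAt)
      (fun t ht => (hx t (interior_subset ht)).mono interior_subset)
      fun t ht => hneg t (interior_subset ht)
  have hm : m ≤ 0 := (hFm 0 ⟨le_rfl, hT⟩).trans hF0
  have hmem : ∀ n ≤ N, (n : ℝ) * dt ∈ Icc 0 T := fun n hn => by
    refine ⟨by positivity, le_trans ?_ hN⟩
    have : (n : ℝ) ≤ N := by exact_mod_cast hn
    gcongr
  -- The upper bound depends on the current velocity `G n` so that it telescopes: adding the
  -- increment `dt * (F ξ - G n)` leaves at most `dt * (F ξ - m)`, and `F` is nondecreasing in time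
  -- and nonpositive. The minimum with `0` keeps the bound usable when `G` exceeds the exact
  -- velocity.
  have key : ∀ n ≤ N, -dt ≤ x (n * dt) - y n ∧ x (n * dt) - y n ≤ dt * (min (G n) 0 - m) := by
    intro n
    induction n with
    | zero =>
      intro hn
      have := (hGm 0 hn).1
      have h2 : 0 ≤ min (G 0) 0 - m := sub_nonneg.2 (le_min this hm)
      simp only [Nat.cast_zero, zero_mul, h0, sub_self]
      exact ⟨by linarith, by positivity⟩
    | succ n ih =>
      intro hn
      obtain ⟨ihl, ihu⟩ := ih (by omega)
      have h1 := hmem n (by omega)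
      have h2 := hmem (n + 1) hn
      have hlt : (n : ℝ) * dt < ((n + 1 : ℕ) : ℝ) * dt := by push_cast; linarith
      have hsub : Icc ((n : ℝ) * dt) (((n + 1 : ℕ) : ℝ) * dt) ⊆ Icc 0 T :=
        Icc_subset_Icc h1.1 h2.2
      obtain ⟨ξ, hξ, hslope⟩ := exists_hasDerivAt_eq_slope x F hlt
        (fun t ht => ((hx t (hsub ht)).continuousWithinAt).mono hsub)
        (fun t ht => (hx t (hsub (Ioo_subset_Icc_self ht))).hasDerivAt
          (Icc_mem_nhds (h1.1.trans_lt ht.1) (ht.2.trans_le h2.2)))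
      have hξT := hsub (Ioo_subset_Icc_self hξ)
      rw [show ((n + 1 : ℕ) : ℝ) * dt - n * dt = dt by push_cast; ring, eq_div_iff hdt.ne'] at hslope
      have hF1 : F (n * dt) ≤ F ξ := hanti _ hξT _ h1 (hxanti h1 hξT hξ.1.le)
      have hF2 : F ξ ≤ F ((n + 1 : ℕ) * dt) := hanti _ h2 _ hξT (hxanti hξT h2 hξ.2.le)
      have hstep := hy n (by omega)
      have hGn := hGm n (by omega)
      have herr : x ((n + 1 : ℕ) * dt) - y (n + 1) = x (n * dt) - y n + dt * (F ξ - G n) := by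
        rw [hstep]; linarith
      constructor
      -- Below the discrete value the error cannot decrease; above it, one step lowers the error by
      -- at most `dt`.
      · rcases le_total (x (n * dt)) (y n) with hc | hc
        · have := hle n (by omega) _ h1 hc
          have : 0 ≤ dt * (F ξ - G n) := mul_nonneg hdt.le (by linarith)
          linarith
        · have := hFm ξ hξT
          have : dt * (-1) ≤ dt * (F ξ - G n) := by
            gcongr
            linarith [hGn.2]
          linarith
      · have hF3 := hneg _ h2
        have hup : x ((n + 1 : ℕ) * dt) - y (n + 1) ≤ dt * (F ((n + 1 : ℕ) * dt) - m) := by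
          have h3 := min_le_left (G n) 0
          have : dt * (min (G n) 0 - m) + dt * (F ξ - G n) ≤ dt * (F ((n + 1 : ℕ) * dt) - m) := by
            rw [← mul_add]
            gcongr
            linarith
          linarith
        rcases le_total (y (n + 1)) (x ((n + 1 : ℕ) * dt)) with hc | hc
        · have := hge (n + 1) hn _ h2 hc
          refine hup.trans ?_
          gcongr
          exact le_min this hF3
        · have h4 : 0 ≤ min (G (n + 1)) 0 - m := sub_nonneg.2 (le_min (hGm _ hn).1 hm)
          have : 0 ≤ dt * (min (G (n + 1)) 0 - m) := by positivity
          linarith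
  intro n hn
  obtain ⟨hl, hu⟩ := key n hn
  refine abs_le.2 ⟨hl, hu.trans ?_⟩
  have h1 := min_le_left (G n) 0
  have h2 := (hGm n hn).2
  calc dt * (min (G n) 0 - m) ≤ dt * 1 := by gcongr; linarith
    _ = dt := mul_one dt

/-- The explicit Euler method for a scalar autonomous equation whose right-hand side is
nonincreasing with oscillation at most one has error at most one time step. -/
theorem euler_error {x F : ℝ → ℝ} {y G : ℕ → ℝ} {T dt m : ℝ} {N : ℕ}
    (hdt : 0 < dt) (hN : N * dt ≤ T)
    (hx : ∀ t ∈ Icc 0 T, HasDerivWithinAt x (F t) (Icc 0 T) t)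
    (hF : ContinuousOn F (Icc 0 T))
    (hanti : ∀ s ∈ Icc 0 T, ∀ t ∈ Icc 0 T, x s ≤ x t → F t ≤ F s)
    (hy : ∀ n < N, y (n + 1) = y n + dt * G n) (h0 : y 0 = x 0)
    (hle : ∀ n ≤ N, ∀ t ∈ Icc 0 T, x t ≤ y n → G n ≤ F t)
    (hge : ∀ n ≤ N, ∀ t ∈ Icc 0 T, y n ≤ x t → F t ≤ G n)
    (hFm : ∀ t ∈ Icc 0 T, F t ∈ Icc m (m + 1))
    (hGm : ∀ n ≤ N, G n ∈ Icc m (m + 1)) : ∀ n ≤ N, |x (n * dt) - y n| ≤ dt := by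
  rcases le_total (F 0) 0 with hF0 | hF0
  · exact euler_error_of_nonpos hdt hN hx hF hanti hy h0 hle hge (fun t ht => (hFm t ht).1) hGm hF0
  · intro n hn
    -- Reflection `x ↦ -x` reverses the velocity and turns the range `[m, m + 1]` into `[-(m + 1),
    -- -m]`.
    have := euler_error_of_nonpos (x := fun t => -x t) (F := fun t => -F t) (y := fun n => -y n)
      (G := fun n => -G n) (m := -(m + 1)) hdt hN (fun t ht => (hx t ht).fun_neg) hF.neg
      (fun s hs t ht hst => neg_le_neg (hanti t ht s hs (neg_le_neg_iff.1 hst)))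
      (fun n hn => by rw [hy n hn]; ring) (by rw [h0])
      (fun n hn t ht hc => neg_le_neg (hge n hn t ht (neg_le_neg_iff.1 hc)))
      (fun n hn t ht hc => neg_le_neg (hle n hn t ht (neg_le_neg_iff.1 hc)))
      (fun t ht => neg_le_neg (hFm t ht).2)
      (fun n hn => ⟨neg_le_neg (hGm n hn).2, by linarith [(hGm n hn).1]⟩) (by simpa using hF0) n hn
    rwa [neg_sub_neg, abs_sub_comm] at this

/-! ### First integral and volume bounds -/

namespace IsQuasiStaticProfile

variable {κ V a b lam : ℝ} {u : ℝ → ℝ}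

theorem firstIntegral_hasDerivAt (h : IsQuasiStaticProfile κ V a b u lam) {x : ℝ}
    (hx : x ∈ Ioo a b) :
    HasDerivAt (fun y => (√(1 + deriv u y ^ 2))⁻¹ + (κ * u y ^ 2 / 2 - lam * u y)) 0 x := by
  have hu := (h.differentiableAt hx).hasDerivAt
  have hp := (h.differentiableAt_deriv hx).hasDerivAt
  have hpos : 0 < 1 + deriv u x ^ 2 := by positivity
  have hs : 0 < √(1 + deriv u x ^ 2) := Real.sqrt_pos.2 hpos
  have hsd := (((hp.fun_pow 2).const_add 1).sqrt hpos.ne').fun_inv hs.ne'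
  have hU := (((hu.fun_pow 2).const_mul κ).div_const 2).fun_sub (hu.const_mul lam)
  refine (hsd.fun_add hU).congr_deriv ?_
  rw [h.deriv_deriv hx]
  set s := √(1 + deriv u x ^ 2)
  field_simp
  push_cast
  ring

/-- The conserved quantity is `cos + κ u² / 2 - lam u`. At the maximum the cosine is one; near the
contact point it is nonnegative and the remaining terms tend to zero. -/
theorem firstIntegral_le_one (h : IsQuasiStaticProfile κ V a b u lam) {x : ℝ}
    (hx : x ∈ Ioo a b) (hmax : IsMaxOn u (Icc a b) x) :
    lam * u x - κ * u x ^ 2 / 2 ≤ 1 := by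
  have hd0 : deriv u x = 0 :=
    (hmax.isLocalMax (Icc_mem_nhds hx.1 hx.2)).deriv_eq_zero
  have hconst : ∀ y ∈ Ioo a b, (√(1 + deriv u y ^ 2))⁻¹ + (κ * u y ^ 2 / 2 - lam * u y) =
      (√(1 + deriv u x ^ 2))⁻¹ + (κ * u x ^ 2 / 2 - lam * u x) := fun y hy =>
    isOpen_Ioo.is_const_of_deriv_eq_zero isPreconnected_Ioo
      (fun z hz => (h.firstIntegral_hasDerivAt hz).differentiableAt.differentiableWithinAt)
      (fun z hz => (h.firstIntegral_hasDerivAt hz).deriv) hy hx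
  have hcont : Filter.Tendsto (fun y => κ * u y ^ 2 / 2 - lam * u y) (nhdsWithin a (Ioi a))
      (nhds (κ * u a ^ 2 / 2 - lam * u a)) := by
    have h1 : Filter.Tendsto u (nhdsWithin a (Ioi a)) (nhds (u a)) :=
      ((h.continuousOn a (left_mem_Icc.2 h.lt.le)).mono_of_mem_nhdsWithin (Icc_mem_nhdsGT h.lt))
    exact (((h1.pow 2).const_mul κ).div_const 2).sub (h1.const_mul lam)
  have hle := le_of_tendsto hcont (b := 1 + (κ * u x ^ 2 / 2 - lam * u x)) (by
    filter_upwards [Ioo_mem_nhdsGT h.lt] with y hy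
    have h1 := hconst y hy
    have h2 : 0 ≤ (√(1 + deriv u y ^ 2))⁻¹ := by positivity
    simp only [hd0, ne_eq, OfNat.ofNat_ne_zero, not_false_eq_true, zero_pow, add_zero,
      Real.sqrt_one, inv_one] at h1
    linarith)
  rw [h.left_zero] at hle
  linarith

theorem mul_sq_argmax_le (h : IsQuasiStaticProfile κ V a b u lam) {x : ℝ}
    (hx : x ∈ Ioo a b) (hmax : IsMaxOn u (Icc a b) x) (hpos : 0 < u x) : κ * u x ^ 2 ≤ 2 := by
  have h1 := h.firstIntegral_le_one hx hmax
  have h2 := mul_le_mul_of_nonneg_right (h.mul_argmax_le hx hmax) hpos.le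
  linarith [mul_assoc κ (u x) (u x), sq (u x), congrArg (κ * ·) (sq (u x))]

/-- The cubic `v` agrees with `u` at `x₀` and `b`. The choice of `k` cancels the linear terms,
giving `v'' ≥ κ (v - u x₀)`, while `κ u x₀ ≤ lam` gives `u'' ≤ κ (u - u x₀)`. Thus `u - v` is
strictly concave wherever it is negative. -/
theorem cubic_le (h : IsQuasiStaticProfile κ V a b u lam) (hκ : 0 < κ) {x₀ : ℝ}
    (hx₀ : x₀ ∈ Ioo a b) (hmax : IsMaxOn u (Icc a b) x₀) (hpos : 0 < u x₀) {k : ℝ}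
    (hk : k * ((b - x₀) * (6 + κ * (b - x₀) ^ 2)) = κ * u x₀) :
    ∀ x ∈ Icc x₀ b, u x₀ * (b - x) / (b - x₀) +
      k * ((x - x₀) * ((b - x₀) ^ 2 - (x - x₀) ^ 2)) ≤ u x := by
  have hL : 0 < b - x₀ := sub_pos.2 hx₀.2
  have hkpos : 0 < k := by
    have : 0 < κ * u x₀ := mul_pos hκ hpos
    rw [← hk] at this
    exact pos_of_mul_pos_left this (by positivity)
  set v : ℝ → ℝ := fun x => u x₀ * (b - x) / (b - x₀) +
      k * ((x - x₀) * ((b - x₀) ^ 2 - (x - x₀) ^ 2)) with hv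
  have hv1 : ∀ x, HasDerivAt v (-u x₀ / (b - x₀) + k * ((b - x₀) ^ 2 - 3 * (x - x₀) ^ 2)) x := by
    intro x
    have hi := (hasDerivAt_id' x).sub_const x₀
    refine (((((hasDerivAt_id' x).const_sub b).const_mul (u x₀)).div_const (b - x₀)).fun_add
      ((hi.fun_mul ((hi.fun_pow 2).const_sub ((b - x₀) ^ 2))).const_mul k)).congr_deriv ?_
    push_cast
    ring
  have hv2 : ∀ x, HasDerivAt (deriv v) (-(6 * k * (x - x₀))) x := by
    intro x
    have hfun : deriv v = fun x => -u x₀ / (b - x₀) + k * ((b - x₀) ^ 2 - 3 * (x - x₀) ^ 2) :=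
      funext fun x => (hv1 x).deriv
    rw [hfun]
    have hi := (hasDerivAt_id' x).sub_const x₀
    refine (((((hi.fun_pow 2).const_mul 3).const_sub ((b - x₀) ^ 2)).const_mul k).const_add
      (-u x₀ / (b - x₀))).congr_deriv ?_
    push_cast
    ring
  have hsub : Icc x₀ b ⊆ Icc a b := Icc_subset_Icc hx₀.1.le le_rfl
  have hvc : Continuous v := continuous_iff_continuousAt.2 fun x => (hv1 x).continuousAt
  intro x hx
  have := nonneg_of_deriv_deriv_neg (f := u - v)
    ((h.continuousOn.mono hsub).sub hvc.continuousOn)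
    (by simp [hv, hL.ne']) (by simp [hv, h.right_zero]) (fun y hy hy0 _ => by
      have hy' : y ∈ Ioo a b := ⟨hx₀.1.trans hy.1, hy.2⟩
      have heq : deriv (u - v) =ᶠ[nhds y] deriv u - deriv v := by
        filter_upwards [isOpen_Ioo.mem_nhds hy'] with z hz
        exact deriv_sub (h.differentiableAt hz) (hv1 z).differentiableAt
      rw [heq.deriv_eq, deriv_sub (h.differentiableAt_deriv hy') (hv2 y).differentiableAt,
        (hv2 y).deriv, h.deriv_deriv hy']
      have h1 := h.mul_argmax_le hx₀ hmax
      have h2 : u y ≤ u x₀ := hmax (Ioo_subset_Icc_self hy')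
      have h3 : κ * u y ≤ κ * u x₀ := by gcongr
      have h4 : 1 ≤ √(1 + deriv u y ^ 2) ^ 3 :=
        one_le_pow₀ (Real.one_le_sqrt.2 (le_add_of_nonneg_right (sq_nonneg _)))
      have h5 : (κ * u y - lam) * √(1 + deriv u y ^ 2) ^ 3 ≤ κ * u y - lam := by
        nlinarith
      have h6 : κ * u y < κ * v y := by
        have : u y < v y := sub_neg.1 hy0
        gcongr
      have hy1 : 0 < y - x₀ := sub_pos.2 hy.1
      have h7 : κ * v y = κ * u x₀ - 6 * k * (y - x₀) - k * κ * (y - x₀) ^ 3 := by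
        have : u x₀ * (b - y) / (b - x₀) = u x₀ - u x₀ / (b - x₀) * (y - x₀) := by
          field_simp
          ring
        have h8 : κ * (u x₀ / (b - x₀)) = k * (6 + κ * (b - x₀) ^ 2) := by
          rw [← mul_div_assoc, ← hk]
          field_simp
        simp only [hv]
        rw [this]
        linear_combination -(y - x₀) * h8
      have h9 : 0 < k * κ * (y - x₀) ^ 3 := by positivity
      linarith) x hx
  exact sub_nonneg.1 this

theorem right_volume_lower_bound (h : IsQuasiStaticProfile κ V a b u lam) (hκ : 0 < κ) {x₀ : ℝ}
    (hx₀ : x₀ ∈ Ioo a b) (hmax : IsMaxOn u (Icc a b) x₀) (hpos : 0 < u x₀) :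
    u x₀ * (b - x₀) / 2 + κ * u x₀ * (b - x₀) ^ 3 / (4 * (6 + κ * (b - x₀) ^ 2)) ≤
      ∫ x in x₀..b, u x := by
  have hL : 0 < b - x₀ := sub_pos.2 hx₀.2
  obtain ⟨k, hk⟩ : ∃ k, k = κ * u x₀ / ((b - x₀) * (6 + κ * (b - x₀) ^ 2)) := ⟨_, rfl⟩
  have hle := h.cubic_le hκ hx₀ hmax hpos (k := k) (by rw [hk]; field_simp)
  have hint : ∫ x in x₀..b, (u x₀ * (b - x) / (b - x₀) +
      k * ((x - x₀) * ((b - x₀) ^ 2 - (x - x₀) ^ 2))) =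
      u x₀ * (b - x₀) / 2 + k * (b - x₀) ^ 4 / 4 := by
    rw [intervalIntegral.integral_eq_sub_of_hasDerivAt
      (f := fun x => -(u x₀ * (b - x) ^ 2 / (2 * (b - x₀))) +
        k * ((b - x₀) ^ 2 * (x - x₀) ^ 2 / 2 - (x - x₀) ^ 4 / 4))
      (fun x _ => ?_) (Continuous.intervalIntegrable (by fun_prop) _ _)]
    · field_simp
      ring
    · have hi := (hasDerivAt_id' x).sub_const x₀
      have hj := (hasDerivAt_id' x).const_sub b
      refine ((((hj.fun_pow 2).const_mul (u x₀)).div_const (2 * (b - x₀))).fun_neg.fun_add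
        (((((hi.fun_pow 2).const_mul ((b - x₀) ^ 2)).div_const 2).fun_sub
          ((hi.fun_pow 4).div_const 4)).const_mul k)).congr_deriv ?_
      push_cast
      field_simp
  have hk4 : κ * u x₀ * (b - x₀) ^ 3 / (4 * (6 + κ * (b - x₀) ^ 2)) = k * (b - x₀) ^ 4 / 4 := by
    rw [hk]
    field_simp
  rw [hk4, ← hint]
  exact intervalIntegral.integral_mono_on hx₀.2.le (Continuous.intervalIntegrable (by fun_prop) _ _)
    ((h.continuousOn.mono (Icc_subset_Icc hx₀.1.le le_rfl)).intervalIntegrable_of_Icc hx₀.2.le) hle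

theorem left_volume_lower_bound (h : IsQuasiStaticProfile κ V a b u lam) (hκ : 0 < κ) {x₀ : ℝ}
    (hx₀ : x₀ ∈ Ioo a b) (hmax : IsMaxOn u (Icc a b) x₀) (hpos : 0 < u x₀) :
    u x₀ * (x₀ - a) / 2 + κ * u x₀ * (x₀ - a) ^ 3 / (4 * (6 + κ * (x₀ - a) ^ 2)) ≤
      ∫ x in a..x₀, u x := by
  have h₂ := h.comp_const_sub 0
  have := h₂.right_volume_lower_bound hκ (x₀ := -x₀)
    ⟨by linarith [hx₀.2], by linarith [hx₀.1]⟩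
    (fun y hy => by
      have : (0 - y) ∈ Icc a b := ⟨by linarith [hy.2], by linarith [hy.1]⟩
      simpa using hmax this) (by simpa using hpos)
  rw [intervalIntegral.integral_comp_sub_left] at this
  simpa [neg_add_eq_sub] using this

/-- The two triangles add up to `(b - a) / 2 * u x₀` wherever the maximum sits. The surplus is kept
only on the longer side, whose length lies between `(b - a) / 2` and `b - a`. -/
theorem volume_lower_bound (h : IsQuasiStaticProfile κ V a b u lam) (hκ : 0 < κ) {x₀ : ℝ}
    (hx₀ : x₀ ∈ Ioo a b) (hmax : IsMaxOn u (Icc a b) x₀) (hpos : 0 < u x₀) :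
    (b - a) / 2 * u x₀ + κ * u x₀ * ((b - a) / 2) ^ 3 / (4 * (6 + κ * (b - a) ^ 2)) ≤ V := by
  have hl := h.left_volume_lower_bound hκ hx₀ hmax hpos
  have hr := h.right_volume_lower_bound hκ hx₀ hmax hpos
  have hadd := intervalIntegral.integral_add_adjacent_intervals
    ((h.continuousOn.mono (Icc_subset_Icc le_rfl hx₀.2.le)).intervalIntegrable_of_Icc
      (μ := MeasureTheory.volume) hx₀.1.le)
    ((h.continuousOn.mono (Icc_subset_Icc hx₀.1.le le_rfl)).intervalIntegrable_of_Icc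
      (μ := MeasureTheory.volume) hx₀.2.le)
  rw [h.volume] at hadd
  have hgain : ∀ L, (b - a) / 2 ≤ L → L ≤ b - a →
      κ * u x₀ * ((b - a) / 2) ^ 3 / (4 * (6 + κ * (b - a) ^ 2)) ≤
        κ * u x₀ * L ^ 3 / (4 * (6 + κ * L ^ 2)) := by
    intro L h1 h2
    have h3 := h.lt
    have : 0 < b - a := sub_pos.2 h3
    have : 0 < L := by linarith
    gcongr
  have hx1 := sub_pos.2 hx₀.1
  have hx2 := sub_pos.2 hx₀.2
  have hn1 : 0 ≤ κ * u x₀ * (x₀ - a) ^ 3 / (4 * (6 + κ * (x₀ - a) ^ 2)) := by positivity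
  have hn2 : 0 ≤ κ * u x₀ * (b - x₀) ^ 3 / (4 * (6 + κ * (b - x₀) ^ 2)) := by positivity
  rcases le_total ((b - a) / 2) (b - x₀) with hc | hc
  · have := hgain _ hc (by linarith)
    linarith
  · have := hgain (x₀ - a) (by linarith) (by linarith)
    linarith

theorem volume_le (h : IsQuasiStaticProfile κ V a b u lam) {x₀ : ℝ}
    (hmax : IsMaxOn u (Icc a b) x₀) : V ≤ (b - a) * u x₀ := by
  have := intervalIntegral.integral_mono_on (μ := MeasureTheory.volume) h.lt.le
    (h.continuousOn.intervalIntegrable_of_Icc h.lt.le)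
    (intervalIntegrable_const (c := u x₀)) fun y hy => hmax hy
  rwa [h.volume, intervalIntegral.integral_const, smul_eq_mul] at this

end IsQuasiStaticProfile

/-! ### Finiteness and sign of the constant -/

theorem argmax_of_isGreatest {κ V β lam um : ℝ} {u : ℝ → ℝ}
    (h : IsQuasiStaticProfile κ V (-β) β u lam) (hV : 0 < V)
    (hum : IsGreatest (u '' Icc (-β) β) um) :
    ∃ x ∈ Ioo (-β) β, IsMaxOn u (Icc (-β) β) x ∧ 0 < u x ∧ u x = um := by
  obtain ⟨x, hx, hmax, hpos⟩ := h.exists_argmax hV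
  obtain ⟨y, hy, rfl⟩ := hum.1
  exact ⟨x, hx, hmax, hpos, le_antisymm (hum.2 ⟨x, Ioo_subset_Icc_self hx, rfl⟩) (hmax hy)⟩

theorem angleBoundValues_nonneg {κ V l r : ℝ} (hκ : 0 < κ) (hV : 0 < V) :
    ∀ c ∈ angleBoundValues κ V l r, 0 ≤ c := by
  rintro c ⟨β, -, u, lam, um, h, hum, rfl⟩
  obtain ⟨x, hx, hmax, hpos, rfl⟩ := argmax_of_isGreatest h hV hum
  have hβ : 0 < β := by linarith [h.lt]
  have h1 := h.volume_lower_bound hκ hx hmax hpos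
  have h2 : 0 ≤ κ * u x * ((β - -β) / 2) ^ 3 / (4 * (6 + κ * (β - -β) ^ 2)) := by
    rw [sub_neg_eq_add]; positivity
  have : 0 ≤ V - β * u x := by linarith
  positivity

theorem bddAbove_angleBoundValues {κ V l r : ℝ} (hκ : 0 < κ) (hV : 0 < V) :
    BddAbove (angleBoundValues κ V l r) := by
  obtain ⟨M, hM⟩ : ∃ M, M = √(2 / κ) := ⟨_, rfl⟩
  have hMpos : 0 < M := by rw [hM]; positivity
  refine ⟨1 / (κ * (V / (2 * r)) * (V / (2 * M)) ^ 3 / (4 * (6 + κ * (2 * r) ^ 2))) *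
    (6 * V / (V / (2 * r)) + κ * M ^ 3), ?_⟩
  rintro c ⟨β, hβ, u, lam, um, h, hum, rfl⟩
  obtain ⟨x, hx, hmax, hpos, rfl⟩ := argmax_of_isGreatest h hV hum
  have hβ0 : 0 < β := by linarith [h.lt]
  have hr : 0 < r := hβ0.trans_le hβ.2
  have huM : u x ≤ M := by
    rw [hM]
    refine Real.le_sqrt_of_sq_le ?_
    rw [le_div_iff₀ hκ, mul_comm]
    exact h.mul_sq_argmax_le hx hmax hpos
  have hvol := h.volume_le hmax
  -- The inequality `V ≤ 2 β u_m` bounds `β` below through `u_m ≤ M`, and then `u_m` below through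
  -- `β ≤ r`.
  have hβM : V / (2 * M) ≤ β := by
    rw [div_le_iff₀ (by positivity)]
    have : β * u x ≤ β * M := by gcongr
    linarith
  have hur : V / (2 * r) ≤ u x := by
    rw [div_le_iff₀ (by positivity)]
    have : u x * β ≤ u x * r := by gcongr; exact hβ.2
    linarith
  have hlow := h.volume_lower_bound hκ hx hmax hpos
  have h2β : β - -β = 2 * β := by ring
  rw [h2β, mul_div_cancel_left₀ _ two_ne_zero] at hlow
  have hgap : κ * (V / (2 * r)) * (V / (2 * M)) ^ 3 / (4 * (6 + κ * (2 * r) ^ 2)) ≤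
      V - β * u x := by
    refine le_trans ?_ (le_sub_iff_add_le'.2 hlow)
    gcongr
    exact hβ.2
  have : 0 < κ * (V / (2 * r)) * (V / (2 * M)) ^ 3 / (4 * (6 + κ * (2 * r) ^ 2)) := by positivity
  gcongr

theorem nonempty_angleBoundValues {κ V a b lam l r : ℝ} {u : ℝ → ℝ}
    (h : IsQuasiStaticProfile κ V a b u lam) (hV : 0 < V) (hmem : (b - a) / 2 ∈ Icc l r) :
    (angleBoundValues κ V l r).Nonempty := by
  have h₂ := h.comp_add_const ((a + b) / 2)
  rw [show a - (a + b) / 2 = -((b - a) / 2) by ring, show b - (a + b) / 2 = (b - a) / 2 by ring] at h₂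
  obtain ⟨x, hx, hmax, -⟩ := h₂.exists_argmax hV
  exact ⟨_, (b - a) / 2, hmem, _, lam, _, h₂,
    ⟨⟨x, Ioo_subset_Icc_self hx, rfl⟩, forall_mem_image.2 hmax⟩, rfl⟩

theorem angleBound_nonneg {κ V l r : ℝ} (hκ : 0 < κ) (hV : 0 < V) : 0 ≤ angleBound κ V l r :=
  Real.sSup_nonneg (angleBoundValues_nonneg hκ hV)

/-! ### Conservation of the midpoint and the error estimate -/

theorem IsFirstOrderScheme.add_eq {κ σ V dt : ℝ} {N : ℕ} {an bn : ℕ → ℝ} {un : ℕ → ℝ → ℝ}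
    {lamn : ℕ → ℝ} (h : IsFirstOrderScheme κ σ dt N an bn un lamn) (hκ : 0 < κ) (hV : 0 < V)
    (hdt : 0 < dt)
    (hprof : ∀ n ≤ N, ∃ lam, IsQuasiStaticProfile κ V (an n) (bn n) (un n) lam) :
    ∀ n ≤ N, an n + bn n = an 0 + bn 0 := by
  intro n
  induction n with
  | zero => simp
  | succ n ih =>
    intro hn
    rw [← ih (by omega)]
    obtain ⟨lam, hp⟩ := hprof n (by omega)
    have h1 := h.left_update n (by omega)
    have h2 := h.right_update n (by omega)
    rw [hp.cosAngleRight_eq_cosAngleLeft hκ hV] at h2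
    rw [div_eq_iff hdt.ne'] at h1 h2
    linarith

theorem IsQuasiStaticSolution.add_eq {κ V σ T : ℝ} {a b : ℝ → ℝ} {u : ℝ → ℝ → ℝ} {lam : ℝ → ℝ}
    (h : IsQuasiStaticSolution κ V σ T a b u lam) (hκ : 0 < κ) (hV : 0 < V) :
    ∀ t ∈ Icc 0 T, a t + b t = a 0 + b 0 := by
  intro t ht
  have hd : ∀ s ∈ Icc 0 T, HasDerivWithinAt (fun s => a s + b s) 0 (Icc 0 T) s := fun s hs => by
    refine ((h.left_speed s hs).fun_add (h.right_speed s hs)).congr_deriv ?_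
    rw [(h.profile s hs).cosAngleRight_eq_cosAngleLeft hκ hV]
    ring
  exact constant_of_derivWithin_zero (fun s hs => (hd s hs).differentiableWithinAt)
    (fun s hs => (hd s (Ico_subset_Icc_self hs)).derivWithin
      (uniqueDiffOn_Icc (hs.1.trans_lt hs.2) s (Ico_subset_Icc_self hs))) t ht

theorem mainTheorem1
    (κ V σ T : ℝ) (hκ : 0 < κ) (hV : 0 < V) (hσ : |σ| ≤ 1) (hT : 0 < T)
    (a b : ℝ → ℝ) (u : ℝ → ℝ → ℝ) (lam : ℝ → ℝ)
    (hexact : IsQuasiStaticSolution κ V σ T a b u lam)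
    (l r : ℝ)
    (hexact_mem : ∀ t ∈ Set.Icc 0 T, (b t - a t) / 2 ∈ Set.Icc l r)
    (dt : ℝ) (hdt : 0 < dt) (N : ℕ) (hN : N * dt ≤ T)
    (an bn : ℕ → ℝ) (un : ℕ → ℝ → ℝ) (lamn : ℕ → ℝ)
    (hscheme : IsFirstOrderScheme κ σ dt N an bn un lamn)
    (ha0 : an 0 = a 0) (hb0 : bn 0 = b 0)
    (hu0 : Set.EqOn (un 0) (u 0) (Set.Icc (a 0) (b 0)))
    (hscheme_mem : ∀ n ≤ N, (bn n - an n) / 2 ∈ Set.Icc l r) :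
    IsLUB (angleBoundValues κ V l r) (angleBound κ V l r) ∧
      ∀ n ≤ N,
        |b (n * dt) - bn n| ≤ Real.exp (angleBound κ V l r * T) * dt ∧
        |a (n * dt) - an n| ≤ Real.exp (angleBound κ V l r * T) * dt := by
  have h0T : (0 : ℝ) ∈ Icc 0 T := ⟨le_rfl, hT.le⟩
  have hp0 := hexact.profile 0 h0T
  refine ⟨isLUB_csSup (nonempty_angleBoundValues hp0 hV (hexact_mem 0 h0T))
    (bddAbove_angleBoundValues hκ hV), ?_⟩
  have hq0 : IsQuasiStaticProfile κ V (an 0) (bn 0) (un 0) (lam 0) := by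
    rw [ha0, hb0]
    exact hp0.congr hu0
  have hprof : ∀ n ≤ N, ∃ lam, IsQuasiStaticProfile κ V (an n) (bn n) (un n) lam := by
    -- The scheme solves only for steps `n + 1`; step zero inherits its profile, and the volume `V`,
    -- from the exact data.
    rintro (_ | n) hn
    · exact ⟨_, hq0⟩
    · have := hscheme.elliptic n (by omega)
      rw [hq0.volume] at this
      exact ⟨_, this⟩
  have hsum := hexact.add_eq hκ hV
  have hsumn := hscheme.add_eq hκ hV hdt hprof
  have hright : ∀ t ∈ Icc 0 T,
      HasDerivWithinAt b (-σ - cosAngleLeft (a t) (b t) (u t)) (Icc 0 T) t := fun t ht => by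
    rw [← (hexact.profile t ht).cosAngleRight_eq_cosAngleLeft hκ hV]
    exact hexact.right_speed t ht
  have hrange : ∀ (a b : ℝ) (u : ℝ → ℝ),
      -σ - cosAngleLeft a b u ∈ Icc (-σ - 1) (-σ - 1 + 1) := fun a b u => by
    have := IsQuasiStaticProfile.cosAngleLeft_mem_Icc a b u
    constructor <;> linarith [this.1, this.2]
  have herr : ∀ n ≤ N, |b (n * dt) - bn n| ≤ dt := by
    refine euler_error (F := fun t => -σ - cosAngleLeft (a t) (b t) (u t))
      (G := fun n => -σ - cosAngleLeft (an n) (bn n) (un n)) (m := -σ - 1) hdt hN hright ?_ ?_ ?_ hb0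
      ?_ ?_ (fun t _ => hrange _ _ _) (fun n _ => hrange _ _ _)
    -- Continuity of the angle in time is read off from the regularity of `b`, without continuous
    -- dependence of profiles on the width.
    · have hc := hexact.contDiffOn_right.continuousOn_derivWithin (uniqueDiffOn_Icc hT) (by norm_num)
      exact hc.congr fun t ht => ((hright t ht).derivWithin (uniqueDiffOn_Icc hT t ht)).symm
    · intro s hs t ht hst
      have := (hexact.profile s hs).cosAngleLeft_le (hexact.profile t ht) hκ hV
        (by linarith [hsum s hs, hsum t ht])
      linarith
    · intro n hn
      obtain ⟨lam, hp⟩ := hprof n hn.le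
      have h2 := hscheme.right_update n hn
      rw [hp.cosAngleRight_eq_cosAngleLeft hκ hV, div_eq_iff hdt.ne'] at h2
      linarith
    · intro n hn t ht hc
      obtain ⟨lam, hp⟩ := hprof n hn
      have := (hexact.profile t ht).cosAngleLeft_le hp hκ hV (by linarith [hsum t ht, hsumn n hn])
      linarith
    · intro n hn t ht hc
      obtain ⟨lam, hp⟩ := hprof n hn
      have := hp.cosAngleLeft_le (hexact.profile t ht) hκ hV (by linarith [hsum t ht, hsumn n hn])
      linarith
  intro n hn
  have hnT : (n : ℝ) * dt ∈ Icc 0 T := by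
    refine ⟨by positivity, le_trans ?_ hN⟩
    have : (n : ℝ) ≤ N := by exact_mod_cast hn
    gcongr
  have hexp : dt ≤ Real.exp (angleBound κ V l r * T) * dt :=
    le_mul_of_one_le_left hdt.le
      (Real.one_le_exp (mul_nonneg (angleBound_nonneg hκ hV) hT.le))
  refine ⟨(herr n hn).trans hexp, ?_⟩
  have : a (n * dt) - an n = -(b (n * dt) - bn n) := by linarith [hsum _ hnT, hsumn n hn]
  rw [this, abs_neg]
  exact (herr n hn).trans hexp
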